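/- Let $G$ be a countable discrete group. For a map $\sigma\colon G\to \mathrm{Sym}(m)$ ($m\ge 1$, not necessarily a homomorphism) and $F\subseteq G$, let $V_\sigma(F)\subseteq\{1,\dots,m\}$ be the set of all $v$ such that for all $f_1,f_2\in F$ one has $\sigma(f_1)\sigma(f_2)v=\sigma(f_1f_2)v$, and $\sigma(f_1)v\neq\sigma(f_2)v$ if $f_1\ne f_2$. The group $G$ is *sofic* if there are maps $\sigma_i\colon G\to\mathrm{Sym}(m_i)$ with $m_i\ge 1$ ($i\in\mathbb N$), sets $F_1\subseteq F_2\subseteq\cdots$ with $\bigcup_i F_i=G$, and $\epsilon_i\to 0$, such that $|V_{\sigma_i}(F_i)|\ge(1-\epsilon_i)m_i$ for all $i$. For a standard Borel probability space $(K,\kappa)$, the *Bernoulli shift over $G$ with base $(K,\kappa)$* is the system $(G,K^G,\kappa^G)$, where $K^G$ carries the product Borel structure and the product measure $\kappa^G$, and $G$ acts by $(gx)(f)=x(g^{-1}f)$. The *base entropy* $H(\kappa)\in[0,+\infty]$ is $-\sum_{k\in K'}\kappa(\{k\})\log\kappa(\{k\})$ (with $0\log 0=0$) if there is a countable set $K'\subseteq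 K$ with $\kappa(K')=1$, and $+\infty$ otherwise. Two systems $(G,X,\mu)$ and $(G,Y,\nu)$ are *isomorphic* if there are conull measurable sets $X'\subseteq X$, $Y'\subseteq Y$, with $X'$ being $G$-invariant, and a bijection $\phi\colon X'\to Y'$ with $\phi$ and $\phi^{-1}$ measurable, $\phi_*\mu=\nu$, and $\phi(gx)=g\phi(x)$ for all $g\in G$, $x\in X'$. The group $G$ is *Ornstein* if, for any two standard Borel probability spaces $(K,\kappa)$ and $(L,\lambda)$, $H(\kappa)=H(\lambda)$ implies that $(G,K^G,\kappa^G)$ and $(G,L^G,\lambda^G)$ are isomorphic. **Corollary.** Let $G$ be a countable sofic Ornstein group, and let $(K_1,\kappa_1)$, $(K_2,\kappa_2)$ be standard Borel probability spaces. Then $(G,K_1^G,\kappa_1^G)$ is isomorphic to $(G,K_2^G,\kappa_2^G)$ if and only if $H(\kappa_1)=H(\kappa_2)$. (The values $H(\kappa_i)=+\infty$ are allowed.) -/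

import Mathlib

open MeasureTheory Filter
open scoped ENNReal Topology

noncomputable section

/-! ## Sofic groups -/

/-- For a map `σ : G → Sym(m)` (not assumed to be a homomorphism) and `F ⊆ G`, the set `V(F)` of
all `v` on which `σ` is multiplicative and free as far as `F` can see. -/
def soficGoodSet {G : Type*} [Group G] {m : ℕ} (σ : G → Equiv.Perm (Fin m)) (F : Set G) :
    Set (Fin m) :=
  {v | ∀ f₁ ∈ F, ∀ f₂ ∈ F, σ f₁ (σ f₂ v) = σ (f₁ * f₂) v ∧ (f₁ ≠ f₂ → σ f₁ v ≠ σ f₂ v)}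

/-- `σ` is an `(F, ε)`-approximation to `G`: `|V(F)| ≥ (1 - ε) m`. -/
def IsSoficApproxMap {G : Type*} [Group G] {m : ℕ} (σ : G → Equiv.Perm (Fin m)) (F : Set G)
    (ε : ℝ) : Prop :=
  (1 - ε) * (m : ℝ) ≤ ((soficGoodSet σ F).ncard : ℝ)

/-- The sequence of maps `σ i : G → Sym(m i)`, with `m i ≥ 1`, is a sofic approximation to `G`. -/
def IsSoficApproximation {G : Type*} [Group G] (m : ℕ → ℕ)
    (σ : (i : ℕ) → G → Equiv.Perm (Fin (m i))) : Prop :=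
  (∀ i, 1 ≤ m i) ∧
    ∃ (F : ℕ → Set G) (ε : ℕ → ℝ),
      (∀ i, F i ⊆ F (i + 1)) ∧ (⋃ i, F i) = Set.univ ∧ Tendsto ε atTop (𝓝 0) ∧
        ∀ i, IsSoficApproxMap (σ i) (F i) (ε i)

/-- A (countable) group is sofic if it has a sofic approximation. -/
def IsSofic (G : Type*) [Group G] : Prop :=
  ∃ (m : ℕ → ℕ) (σ : (i : ℕ) → G → Equiv.Perm (Fin (m i))), IsSoficApproximation m σ

/-! ## Isomorphism of dynamical systems -/

/-- Two `G`-systems `(G, X, μ)` and `(G, Y, ν)` are isomorphic (measurably conjugate): there are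
conull sets `X' ⊆ X`, `Y' ⊆ Y` and a bijection `φ : X' → Y'`, measurable in both directions, with
`φ_* μ = ν` and `φ (g x) = g φ(x)` for all `g ∈ G` and `x ∈ X'` (in particular `g x ∈ X'`). -/
def IsMeasurablyConjugate (G : Type*) {X Y : Type*} [Group G]
    [MeasurableSpace X] [MulAction G X] [MeasurableSpace Y] [MulAction G Y]
    (μ : Measure X) (ν : Measure Y) : Prop :=
  ∃ (X' : Set X) (Y' : Set Y),
    MeasurableSet X' ∧ MeasurableSet Y' ∧ μ X'ᶜ = 0 ∧ ν Y'ᶜ = 0 ∧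
      ∃ φ : X' ≃ᵐ Y',
        MeasurePreserving φ (μ.comap Subtype.val) (ν.comap Subtype.val) ∧
          ∀ (g : G) (x : X'), ∃ h : g • (x : X) ∈ X',
            (φ ⟨g • (x : X), h⟩ : Y) = g • (φ x : Y)

/-! ## Bernoulli shifts -/

/-- The space `K^G` of all functions `G → K`. It is a separate type because its action of `G` is
the shift, whatever actions `K` may carry. -/
def BernoulliSpace (G K : Type*) : Type _ := G → K

/-- The product Borel structure on `K^G`. -/
instance BernoulliSpace.instMeasurableSpace (G K : Type*) [MeasurableSpace K] :
    MeasurableSpace (BernoulliSpace G K) :=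
  (MeasurableSpace.pi : MeasurableSpace (G → K))

/-- The shift action `(g x)(f) = x (g⁻¹ f)`. -/
instance BernoulliSpace.instMulAction (G K : Type*) [Group G] :
    MulAction G (BernoulliSpace G K) where
  smul g x := fun f : G => x (g⁻¹ * f)
  one_smul x := by
    funext f
    change x (1⁻¹ * f) = x f
    simp
  mul_smul g h x := by
    funext f
    change x ((g * h)⁻¹ * f) = x (h⁻¹ * (g⁻¹ * f))
    simp [mul_assoc]

/-- The product measure `κ^G` on `K^G`. -/
def bernoulliMeasure (G : Type*) {K : Type*} [MeasurableSpace K] (κ : Measure K)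
    [IsProbabilityMeasure κ] : Measure (BernoulliSpace G K) :=
  (Measure.infinitePi (fun _ : G => κ) : Measure (G → K))

/-- The shift preserves the product measure, so the Bernoulli shift is a dynamical system. -/
theorem measurePreserving_bernoulli_smul (G : Type*) {K : Type*} [Group G] [MeasurableSpace K]
    (κ : Measure K) [IsProbabilityMeasure κ] (g : G) :
    MeasurePreserving (fun x : BernoulliSpace G K => g • x) (bernoulliMeasure G κ)
      (bernoulliMeasure G κ) := by
  refine ⟨measurable_pi_lambda _ fun f => measurable_pi_apply (g⁻¹ * f), ?_⟩
  have h := Measure.infinitePi_map_piCongrLeft (μ := fun _ : G => κ) (Equiv.mulLeft g)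
  have e : (fun x : G → K => fun f : G => x (g⁻¹ * f)) =
      MeasurableEquiv.piCongrLeft (fun _ : G => K) (Equiv.mulLeft g) := by
    funext x f
    have := Equiv.piCongrLeft_apply_apply (fun _ : G => K) (Equiv.mulLeft g) x (g⁻¹ * f)
    simp only [Equiv.coe_mulLeft, mul_inv_cancel_left] at this
    exact this.symm
  rw [← e] at h
  exact h

open Classical in
/-- The entropy `H(κ)` of a probability measure `κ`: if `κ` is carried by a countable set, it is
`-∑ κ({k}) log κ({k})` with `0 log 0 = 0` (a sum of non-negative terms, where points outside the
countable set contribute `0`); otherwise it is `+∞`. -/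
def baseEntropy {K : Type*} [MeasurableSpace K] (κ : Measure K) : ℝ≥0∞ :=
  if ∃ K' : Set K, K'.Countable ∧ κ K' = 1 then
    ∑' k : K, ENNReal.ofReal (Real.negMulLog (κ.real {k}))
  else ⊤

/-! ## Ornstein groups -/

/-- `G` is Ornstein: Bernoulli shifts over `G` whose bases are standard Borel probability spaces of
equal entropy are isomorphic. As every standard Borel space is Borel isomorphic to a subset
of the real line, it suffices to let the bases range over `Type`. -/
def IsOrnstein (G : Type*) [Group G] : Prop :=
  ∀ (K L : Type) [MeasurableSpace K] [StandardBorelSpace K] [MeasurableSpace L]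
    [StandardBorelSpace L] (κ : Measure K) (l : Measure L) [IsProbabilityMeasure κ]
    [IsProbabilityMeasure l],
    baseEntropy κ = baseEntropy l →
      IsMeasurablyConjugate G (bernoulliMeasure G κ) (bernoulliMeasure G l)

end

/-!
The Ornstein property gives one direction after the bases have been transferred to `Type` along
Borel isomorphisms. For the other one, it suffices to show `H(κ) ≤ H(l)` when `H(l)` is finite.
Since `H(κ)` is the supremum of the Shannon entropies of finite-valued observables `β` of `κ` (by
Fatou's lemma along a refining sequence of partitions), it suffices to bound `H(β)`.

Label the `m` points of a finite model of `G` independently according to `κ`: the `β`-values of the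
labels have entropy `m H(β)`. From a good point of the model the labels look, on a fixed finite
window, like a configuration of the Bernoulli shift over `κ`. The conjugacy, approximated by
functions of finitely many coordinates, therefore writes a letter at each point, with nearly the
law of a finite quantization of `l`, and a local decoder guesses the `β`-value at most points from
the letters. Describing first the letters and then the corrections of the guesses encodes all
`β`-values at an average cost of `H(l) + o(1)` per point, so that `m H(β) ≤ m (H(l) + o(1))` by
Gibbs' inequality.
-/

theorem le_of_forall_pos_le_add_mul {x y C : ℝ} (h : ∀ ε > 0, x ≤ y + ε * C) : x ≤ y := by
  have hlim : Tendsto (fun ε : ℝ => y + ε * C) (𝓝[>] 0) (𝓝 (y + 0 * C)) :=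
    (tendsto_const_nhds.add (tendsto_id.mul_const C)).mono_left nhdsWithin_le_nhds
  rw [zero_mul, add_zero] at hlim
  exact ge_of_tendsto hlim (eventually_nhdsWithin_of_forall h)

section ShannonEntropy

variable {Ω : Type*} [MeasurableSpace Ω] {P : Measure Ω}
  {α : Type*} [MeasurableSpace α] [MeasurableSingletonClass α]

theorem integrable_comp_of_finite [IsFiniteMeasure P] [Finite α] {X : Ω → α} (hX : Measurable X)
    (f : α → ℝ) : Integrable (fun ω => f (X ω)) P :=
  (Integrable.of_finite (μ := P.map X) (f := f)).comp_measurable hX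

/-- The Shannon entropy of a random variable `X` with countably many values, as the mean of the
information `-log P(X = x)` of its value. -/
noncomputable def shannonEntropy {α : Type*} (P : Measure Ω) (X : Ω → α) : ℝ :=
  ∫ ω, -Real.log (P.real (X ⁻¹' {X ω})) ∂P

theorem shannonEntropy_comp_measurePreserving [Finite α] {Ω' : Type*} [MeasurableSpace Ω']
    {P' : Measure Ω'} {T : Ω' → Ω} (hT : MeasurePreserving T P' P)
    {X : Ω → α} (hX : Measurable X) : shannonEntropy P' (X ∘ T) = shannonEntropy P X := by
  have hlaw (a : α) : P'.real (X ∘ T ⁻¹' {a}) = P.real (X ⁻¹' {a}) :=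
    hT.measureReal_preimage (hX (measurableSet_singleton a)).nullMeasurableSet
  have hlog : StronglyMeasurable fun ω => -Real.log (P.real (X ⁻¹' {X ω})) :=
    ((measurable_of_finite fun a => -Real.log (P.real (X ⁻¹' {a}))).comp hX).stronglyMeasurable
  simp only [shannonEntropy, hlaw, Function.comp_apply]
  rw [← integral_map_of_stronglyMeasurable hT.measurable hlog, hT.map_eq]

theorem ae_measureReal_preimage_singleton_pos {α : Type*} [Countable α] [IsFiniteMeasure P]
    (X : Ω → α) : ∀ᵐ ω ∂P, 0 < P.real (X ⁻¹' {X ω}) := by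
  have h (a : α) : ∀ᵐ ω ∂P, X ω = a → 0 < P.real (X ⁻¹' {X ω}) := by
    by_cases ha : P (X ⁻¹' {a}) = 0
    · filter_upwards [measure_eq_zero_iff_ae_notMem.1 ha] with ω hω hωa
      exact absurd hωa hω
    · refine ae_of_all _ fun ω hω => ?_
      rw [hω]
      exact ENNReal.toReal_pos ha (measure_ne_top _ _)
  filter_upwards [ae_all_iff.2 h] with ω hω using hω _ rfl

theorem shannonEntropy_le_integral_neg_log [Fintype α] [IsProbabilityMeasure P] {X : Ω → α}
    (hX : Measurable X) {q : α → ℝ} (hq : ∀ a, 0 < q a) (hq1 : ∑ a, q a ≤ 1) :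
    shannonEntropy P X ≤ ∫ ω, -Real.log (q (X ω)) ∂P := by
  let p (a : α) : ℝ := P.real (X ⁻¹' {a})
  have hratio : ∫ ω, q (X ω) / p (X ω) ∂P ≤ 1 := by
    have hlaw : ∫ ω, q (X ω) / p (X ω) ∂P = ∑ a, p a * (q a / p a) := by
      rw [← integral_map (f := fun a => q a / p a) hX.aemeasurable
        (measurable_of_finite _).aestronglyMeasurable, integral_fintype Integrable.of_finite]
      simp only [p, map_measureReal_apply hX (measurableSet_singleton _), smul_eq_mul]
    refine hlaw.trans_le ((Finset.sum_le_sum fun a _ => ?_).trans hq1)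
    rw [mul_div_left_comm]
    exact mul_le_of_le_one_right (hq a).le (div_self_le_one _)
  have hlog : ∀ᵐ ω ∂P, -Real.log (p (X ω)) ≤ -Real.log (q (X ω)) + (q (X ω) / p (X ω) - 1) := by
    filter_upwards [ae_measureReal_preimage_singleton_pos X] with ω hω
    have := Real.log_le_sub_one_of_pos (div_pos (hq (X ω)) hω)
    rw [Real.log_div (hq _).ne' hω.ne'] at this
    linarith
  have hint (f : α → ℝ) : Integrable (fun ω => f (X ω)) P := integrable_comp_of_finite hX f
  calc shannonEntropy P X
      ≤ ∫ ω, (-Real.log (q (X ω)) + (q (X ω) / p (X ω) - 1)) ∂P :=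
        integral_mono_ae (hint fun a => -Real.log (p a))
          (hint fun a => -Real.log (q a) + (q a / p a - 1)) hlog
    _ = ∫ ω, -Real.log (q (X ω)) ∂P + (∫ ω, q (X ω) / p (X ω) ∂P - 1) := by
        rw [integral_add (hint fun a => -Real.log (q a)) (hint fun a => q a / p a - 1),
          integral_sub (hint fun a => q a / p a) (integrable_const 1)]
        simp only [integral_const, probReal_univ, smul_eq_mul, mul_one]
    _ ≤ ∫ ω, -Real.log (q (X ω)) ∂P := by linarith

theorem shannonEntropy_comp_le [Finite α] {β : Type*} [IsFiniteMeasure P] {X : Ω → α}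
    (hX : Measurable X) (f : α → β) :
    shannonEntropy P (f ∘ X) ≤ shannonEntropy P X := by
  refine integral_mono_ae
    (integrable_comp_of_finite hX fun a => -Real.log (P.real (f ∘ X ⁻¹' {f a})))
    (integrable_comp_of_finite hX fun a => -Real.log (P.real (X ⁻¹' {a}))) ?_
  filter_upwards [ae_measureReal_preimage_singleton_pos X] with ω hω
  exact neg_le_neg (Real.log_le_log hω (measureReal_mono fun ω' hω' => congrArg f hω'))

theorem shannonEntropy_pi {V : Type*} [Fintype V] {α : V → Type*} [∀ v, Finite (α v)]
    [∀ v, MeasurableSpace (α v)] [∀ v, MeasurableSingletonClass (α v)]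
    {X : (v : V) → Ω → α v} (hX : ∀ v, Measurable (X v))
    (hindep : ProbabilityTheory.iIndepFun X P) :
    shannonEntropy P (fun ω v => X v ω) = ∑ v, shannonEntropy P (X v) := by
  have := hindep.isProbabilityMeasure
  have hlaw (x : (v : V) → α v) :
      P.real ((fun ω v => X v ω) ⁻¹' {x}) = ∏ v, P.real (X v ⁻¹' {x v}) := by
    have hpre : (fun ω v => X v ω) ⁻¹' {x} = ⋂ v, X v ⁻¹' {x v} := by
      ext ω; simp [funext_iff]
    rw [hpre, measureReal_def, hindep.meas_iInter fun v => ⟨_, measurableSet_singleton _, rfl⟩,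
      ENNReal.toReal_prod]
    rfl
  have hpos := ae_all_iff.2 fun v => ae_measureReal_preimage_singleton_pos (P := P) (X v)
  simp only [shannonEntropy]
  rw [← integral_finsetSum _ fun v _ =>
    integrable_comp_of_finite (hX v) fun a => -Real.log (P.real (X v ⁻¹' {a}))]
  refine integral_congr_ae ?_
  filter_upwards [hpos] with ω hω
  rw [hlaw, Real.log_prod fun v _ => (hω v).ne', Finset.sum_neg_distrib]

end ShannonEntropy

section Coding

/-- The length, in natural units, of the code word of a letter `a`, a symbol `b` and a guess `b'`
for `b`, when `a` is encoded with the weights `W` and `b` is then encoded with the weights `w b'`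
that depend on the guess. -/
noncomputable def codeLength {α B : Type*} (W : α → ℝ) (w : B → B → ℝ) (u : α × B × B) : ℝ :=
  -Real.log (W u.1) - Real.log (w u.2.2 u.2.1)

variable {V α B : Type*} [Fintype V] [Fintype α] [Fintype B] {W : α → ℝ} {w : B → B → ℝ}

/-- Kraft's inequality for the code that describes a string of letters and then, with the help of
the guesses `d v a` computed from it, a string of symbols. -/
theorem sum_prod_mul_le_one (hW : ∀ a, 0 ≤ W a) (hW1 : ∑ a, W a ≤ 1) (hw : ∀ b b', 0 ≤ w b b')
    (hw1 : ∀ b, ∑ b', w b b' ≤ 1) [DecidableEq V] (d : V → (V → α) → B) :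
    ∑ z : (V → α) × (V → B), ∏ v, (W (z.1 v) * w (d v z.1) (z.2 v)) ≤ 1 := by
  have hletters : ∑ a : V → α, ∏ v, W (a v) ≤ 1 := by
    rw [← Fintype.piFinset_univ, ← Finset.prod_univ_sum]
    exact Finset.prod_le_one (fun v _ => Finset.sum_nonneg fun a _ => hW a) fun v _ => hW1
  have hsymbols (a : V → α) : ∑ b : V → B, ∏ v, w (d v a) (b v) ≤ 1 := by
    rw [← Fintype.piFinset_univ, ← Finset.prod_univ_sum]
    exact Finset.prod_le_one (fun v _ => Finset.sum_nonneg fun b _ => hw _ b) fun v _ => hw1 _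
  simp_rw [Fintype.sum_prod_type, Finset.prod_mul_distrib, ← Finset.mul_sum]
  exact (Finset.sum_le_sum fun a _ => mul_le_of_le_one_right
    (Finset.prod_nonneg fun v _ => hW _) (hsymbols a)).trans hletters

variable [MeasurableSpace α] [MeasurableSingletonClass α] [MeasurableSpace B]
  [MeasurableSingletonClass B] {Ω : Type*} [MeasurableSpace Ω] {P : Measure Ω}

theorem sum_shannonEntropy_le_sum_integral_codeLength (hW : ∀ a, 0 < W a) (hW1 : ∑ a, W a ≤ 1)
    (hw : ∀ b b', 0 < w b b') (hw1 : ∀ b, ∑ b', w b b' ≤ 1)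
    {X : V → Ω → B} (hX : ∀ v, Measurable (X v)) (hindep : ProbabilityTheory.iIndepFun X P)
    {A : Ω → V → α} (hA : Measurable A) (d : V → (V → α) → B) :
    ∑ v, shannonEntropy P (X v) ≤ ∑ v, ∫ ω, codeLength W w (A ω v, X v ω, d v (A ω)) ∂P := by
  classical
  have := hindep.isProbabilityMeasure
  have hZ : Measurable fun ω => (A ω, fun v => X v ω) := hA.prodMk (measurable_pi_lambda _ hX)
  calc ∑ v, shannonEntropy P (X v)
      = shannonEntropy P (fun ω v => X v ω) := (shannonEntropy_pi hX hindep).symm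
    _ ≤ shannonEntropy P (fun ω => (A ω, fun v => X v ω)) := shannonEntropy_comp_le hZ Prod.snd
    _ ≤ ∫ ω, -Real.log (∏ v, (W (A ω v) * w (d v (A ω)) (X v ω))) ∂P :=
        shannonEntropy_le_integral_neg_log hZ
          (q := fun z => ∏ v, (W (z.1 v) * w (d v z.1) (z.2 v)))
          (fun z => Finset.prod_pos fun v _ => mul_pos (hW _) (hw _ _))
          (sum_prod_mul_le_one (fun a => (hW a).le) hW1 (fun b b' => (hw b b').le) hw1 d)
    _ = ∫ ω, ∑ v, codeLength W w (A ω v, X v ω, d v (A ω)) ∂P := by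
        refine integral_congr_ae (ae_of_all _ fun ω => ?_)
        simp only [Real.log_prod fun _ _ => (mul_pos (hW _) (hw _ _)).ne',
          Real.log_mul (hW _).ne' (hw _ _).ne', ← Finset.sum_neg_distrib, neg_add', codeLength]
    _ = ∑ v, ∫ ω, codeLength W w (A ω v, X v ω, d v (A ω)) ∂P :=
        integral_finsetSum _ fun v _ => integrable_comp_of_finite hZ
          fun z => codeLength W w (z.1 v, z.2 v, d v z.1)

end Coding

section MixWithUniform

variable {α : Type*} [Fintype α] {δ : ℝ} {p : α → ℝ}

/-- The mixture of the weights `p` with the uniform distribution, which receives the mass `δ`. It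
makes all weights positive at a small cost in code length. -/
noncomputable def mixWithUniform (δ : ℝ) (p : α → ℝ) (a : α) : ℝ :=
  (1 - δ) * p a + δ / Fintype.card α

theorem sum_mixWithUniform [Nonempty α] (hp : ∑ a, p a = 1) : ∑ a, mixWithUniform δ p a = 1 := by
  simp only [mixWithUniform, Finset.sum_add_distrib, ← Finset.mul_sum, hp, Finset.sum_const,
    Finset.card_univ, nsmul_eq_mul]
  field_simp
  ring

theorem div_card_pos (hδ₀ : 0 < δ) (a : α) : 0 < δ / Fintype.card α :=
  div_pos hδ₀ (Nat.cast_pos.2 (Fintype.card_pos_iff.2 ⟨a⟩))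

theorem div_card_le_mixWithUniform (hδ₁ : δ < 1) {a : α} (ha : 0 ≤ p a) :
    δ / Fintype.card α ≤ mixWithUniform δ p a :=
  le_add_of_nonneg_left (mul_nonneg (sub_pos.2 hδ₁).le ha)

theorem mixWithUniform_pos (hδ₀ : 0 < δ) (hδ₁ : δ < 1) {a : α} (ha : 0 ≤ p a) :
    0 < mixWithUniform δ p a :=
  (div_card_pos hδ₀ a).trans_le (div_card_le_mixWithUniform hδ₁ ha)

theorem neg_log_mixWithUniform_le (hδ₀ : 0 < δ) (hδ₁ : δ < 1) {a : α} (ha : 0 < p a) :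
    -Real.log (mixWithUniform δ p a) ≤ -Real.log (1 - δ) - Real.log (p a) := by
  rw [← neg_add', ← Real.log_mul (sub_pos.2 hδ₁).ne' ha.ne']
  exact neg_le_neg (Real.log_le_log (mul_pos (sub_pos.2 hδ₁) ha)
    (le_add_of_nonneg_right (div_card_pos hδ₀ a).le))

section Fano

variable {B : Type*} [Fintype B]

/-- The weights for correcting a guess `b'`: almost all of the mass is on `b'` itself, and the
rest is spread uniformly. -/
noncomputable def correctionWeight (δ : ℝ) (b' : B) : B → ℝ :=
  mixWithUniform δ (Set.indicator {b'} 1)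

theorem correctionWeight_pos (hδ₀ : 0 < δ) (hδ₁ : δ < 1) (b' b : B) :
    0 < correctionWeight δ b' b :=
  mixWithUniform_pos hδ₀ hδ₁ (Set.indicator_apply_nonneg fun _ => zero_le_one)

theorem sum_correctionWeight (b' : B) : ∑ b, correctionWeight δ b' b = 1 := by
  classical
  have : Nonempty B := ⟨b'⟩
  exact sum_mixWithUniform (by simp [Set.indicator_apply])

theorem neg_log_correctionWeight_le (hδ₀ : 0 < δ) (hδ₁ : δ < 1) (b' b : B) :
    -Real.log (correctionWeight δ b' b) ≤
      -Real.log (1 - δ) +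
        ({b'}ᶜ : Set B).indicator (fun _ => -Real.log (δ / Fintype.card B)) b := by
  have hlog : 0 ≤ -Real.log (1 - δ) :=
    neg_nonneg.2 (Real.log_nonpos (sub_pos.2 hδ₁).le (sub_le_self 1 hδ₀.le))
  rcases eq_or_ne b b' with rfl | hb
  · have h := neg_log_mixWithUniform_le (p := Set.indicator {b} 1) (a := b) hδ₀ hδ₁ (by simp)
    simpa [correctionWeight] using h
  · rw [Set.indicator_of_mem (by simpa using hb)]
    have hle := div_card_le_mixWithUniform (p := Set.indicator {b'} 1) (a := b) hδ₁
      (Set.indicator_apply_nonneg fun _ => zero_le_one)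
    exact (neg_le_neg (Real.log_le_log (div_card_pos hδ₀ b) hle)).trans
      (le_add_of_nonneg_left hlog)

variable [MeasurableSpace α] [MeasurableSingletonClass α] [MeasurableSpace B]
  [MeasurableSingletonClass B] {Ω : Type*} [MeasurableSpace Ω] {P : Measure Ω}
  [IsProbabilityMeasure P]

theorem integral_codeLength_correctionWeight_le (hδ₀ : 0 < δ) (hδ₁ : δ < 1) {X : Ω → α}
    (hX : Measurable X) {Y Z : Ω → B} (hY : Measurable Y) (hZ : Measurable Z) :
    ∫ ω, codeLength (mixWithUniform δ fun a => P.real (X ⁻¹' {a})) (correctionWeight δ)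
        (X ω, Y ω, Z ω) ∂P ≤
      shannonEntropy P X - 2 * Real.log (1 - δ) -
        Real.log (δ / Fintype.card B) * P.real {ω | Y ω ≠ Z ω} := by
  have hne : MeasurableSet {ω | Y ω ≠ Z ω} := (measurableSet_eq_fun hY hZ).compl
  have hXint := integrable_comp_of_finite (P := P) hX fun a => -Real.log (P.real (X ⁻¹' {a}))
  have hbadint := (integrable_const (μ := P) (-Real.log (δ / Fintype.card B))).indicator hne
  have hpointwise : ∀ᵐ ω ∂P,
      codeLength (mixWithUniform δ fun a => P.real (X ⁻¹' {a})) (correctionWeight δ)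
        (X ω, Y ω, Z ω) ≤ -Real.log (P.real (X ⁻¹' {X ω})) + -(2 * Real.log (1 - δ)) +
          {ω | Y ω ≠ Z ω}.indicator (fun _ => -Real.log (δ / Fintype.card B)) ω := by
    filter_upwards [ae_measureReal_preimage_singleton_pos X] with ω hω
    have hletter := neg_log_mixWithUniform_le (p := fun a => P.real (X ⁻¹' {a})) hδ₀ hδ₁ hω
    have hsymbol := neg_log_correctionWeight_le hδ₀ hδ₁ (Z ω) (Y ω)
    have hbad : ({Z ω}ᶜ : Set B).indicator (fun _ => -Real.log (δ / Fintype.card B)) (Y ω) =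
      {ω | Y ω ≠ Z ω}.indicator (fun _ => -Real.log (δ / Fintype.card B)) ω := rfl
    rw [codeLength, ← hbad]
    linarith
  have hconst : Integrable (fun _ => -(2 * Real.log (1 - δ))) P := integrable_const _
  refine (integral_mono_ae (integrable_comp_of_finite (hX.prodMk (hY.prodMk hZ)) _)
    ((hXint.add hconst).add hbadint) hpointwise).trans_eq ?_
  rw [integral_add' (hXint.add hconst) hbadint,
    integral_add' hXint hconst, integral_indicator_const _ hne]
  simp only [shannonEntropy, integral_const, probReal_univ, smul_eq_mul]
  ring

end Fano

end MixWithUniform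

section FiniteValuedApproximation

variable {Ω : Type*} [MeasurableSpace Ω] {P : Measure Ω}

theorem integral_comp_le_add_mul_measureReal_ne [IsFiniteMeasure P] {α : Type*} [Finite α]
    [MeasurableSpace α] [MeasurableSingletonClass α] {J : α → ℝ} {C : ℝ}
    (hJ : ∀ u u', J u ≤ J u' + C) {X Y : Ω → α} (hX : Measurable X) (hY : Measurable Y) :
    ∫ ω, J (X ω) ∂P ≤ ∫ ω, J (Y ω) ∂P + P.real {ω | X ω ≠ Y ω} * C := by
  have hne : MeasurableSet {ω | X ω ≠ Y ω} := (measurableSet_eq_fun hX hY).compl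
  have hJY := integrable_comp_of_finite (P := P) hY J
  have hC := (integrable_const (μ := P) C).indicator hne
  rw [← smul_eq_mul, ← integral_indicator_const C hne, ← integral_add hJY hC]
  refine integral_mono (integrable_comp_of_finite hX J) (hJY.add hC) fun ω => ?_
  by_cases h : X ω = Y ω
  · simp [h]
  · simpa [h] using hJ (X ω) (Y ω)

theorem measureReal_exists_mem_preimage_le {ι Ω' : Type*} [MeasurableSpace Ω'] {Q : Measure Ω'}
    {T : ι → Ω → Ω'} (hT : ∀ i, MeasurePreserving (T i) P Q) (D : Finset ι) {N : Set Ω'}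
    (hN : MeasurableSet N) : P.real {ω | ∃ i ∈ D, T i ω ∈ N} ≤ D.card * Q.real N := by
  have hunion : {ω | ∃ i ∈ D, T i ω ∈ N} = ⋃ i ∈ D, T i ⁻¹' N := by ext; simp
  rw [hunion, ← nsmul_eq_mul, ← Finset.sum_const]
  refine (measureReal_biUnion_finset_le D _).trans_eq (Finset.sum_congr rfl fun i _ => ?_)
  exact (hT i).measureReal_preimage hN.nullMeasurableSet

end FiniteValuedApproximation

section Local

variable {ι K α β : Type*} [MeasurableSpace K] [MeasurableSpace α] [MeasurableSpace β]

/-- A measurable function on a product space that depends on finitely many coordinates. -/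
def IsLocal (f : (ι → K) → α) : Prop :=
  Measurable f ∧ ∃ E : Finset ι, DependsOn f E

theorem isLocal_eval (i : ι) : IsLocal fun x : ι → K => x i :=
  ⟨measurable_pi_apply i, {i}, fun _ _ h => h i (by simp)⟩

theorem IsLocal.comp {f : (ι → K) → α} (hf : IsLocal f) {φ : α → β} (hφ : Measurable φ) :
    IsLocal fun x => φ (f x) :=
  ⟨hφ.comp hf.1, hf.2.imp fun _ hE _ _ h => congrArg φ (hE h)⟩

theorem IsLocal.prodMk {f : (ι → K) → α} {g : (ι → K) → β} (hf : IsLocal f) (hg : IsLocal g) :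
    IsLocal fun x => (f x, g x) := by
  classical
  obtain ⟨hfm, E, hE⟩ := hf
  obtain ⟨hgm, D, hD⟩ := hg
  refine ⟨hfm.prodMk hgm, E ∪ D, fun x y h => Prod.ext (hE fun i hi => h i ?_)
    (hD fun i hi => h i ?_)⟩ <;> simp_all

theorem isLocal_pi {J : Type*} [Finite J] {f : J → (ι → K) → α} (hf : ∀ j, IsLocal (f j)) :
    IsLocal fun x j => f j x := by
  classical
  cases nonempty_fintype J
  choose hfm E hE using hf
  exact ⟨measurable_pi_lambda _ hfm, Finset.univ.biUnion E, fun x y h => funext fun j =>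
    hE j fun i hi => h i (Finset.mem_biUnion.2 ⟨j, Finset.mem_univ j, hi⟩)⟩

theorem isLocal_mem_of_mem_measurableCylinders {C : Set (ι → K)}
    (hC : C ∈ measurableCylinders fun _ : ι => K) : IsLocal fun x => x ∈ C := by
  refine ⟨measurableSet_setOfPred.1 (MeasurableSet.of_mem_measurableCylinders hC), ?_⟩
  obtain ⟨E, S, -, rfl⟩ := (mem_measurableCylinders C).1 hC
  exact ⟨E, fun x y h => congrArg (· ∈ S) (Finset.dependsOn_restrict E h)⟩

theorem integral_infinitePi_comp_of_injective {V : Type*} (κ : Measure K) [IsProbabilityMeasure κ]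
    {g : (ι → K) → ℝ} (hg : Measurable g) {r : ι → V} (hr : r.Injective) :
    ∫ ω, g (fun i => ω (r i)) ∂Measure.infinitePi (fun _ : V => κ) =
      ∫ x, g x ∂Measure.infinitePi (fun _ : ι => κ) := by
  rw [← Measure.map_infinitePi_infinitePi_of_inj (P := fun _ : V => κ) hr,
    integral_map_of_stronglyMeasurable (by fun_prop) hg.stronglyMeasurable]

theorem integral_infinitePi_comp_of_injOn {V : Type*} (κ : Measure K) [IsProbabilityMeasure κ]
    {f : (ι → K) → ℝ} (hf : Measurable f) {T : Finset ι} (hT : DependsOn f T) {s : ι → V}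
    (hs : Set.InjOn s T) :
    ∫ ω, f (fun i => ω (s i)) ∂Measure.infinitePi (fun _ : V => κ) =
      ∫ x, f x ∂Measure.infinitePi (fun _ : ι => κ) := by
  classical
  obtain ⟨x₀⟩ : Nonempty (ι → K) := nonempty_of_isProbabilityMeasure (.infinitePi fun _ => κ)
  let g (z : T → K) : ℝ := f (Function.updateFinset x₀ T z)
  have hg : Measurable g := hf.comp measurable_updateFinset
  have hfg (x : ι → K) : f x = g fun t => x t :=
    hT fun i hi => by simp [Function.updateFinset, Finset.mem_coe.1 hi]
  simp only [hfg]
  rw [integral_infinitePi_comp_of_injective κ hg Subtype.val_injective]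
  exact integral_infinitePi_comp_of_injective κ hg (Set.injOn_iff_injective.1 hs)

/-- Cylinder sets are dense in the measure algebra, so the level sets of `f` can be approximated
one by one. -/
theorem exists_isLocal_approx [MeasurableSingletonClass α] [Finite α] (μ : Measure (ι → K))
    [IsProbabilityMeasure μ] {f : (ι → K) → α} (hf : Measurable f) {η : ℝ} (hη : 0 < η) :
    ∃ g : (ι → K) → α, IsLocal g ∧ μ.real {x | f x ≠ g x} ≤ η := by
  classical
  cases nonempty_fintype α
  obtain ⟨x₀⟩ : Nonempty (ι → K) := nonempty_of_isProbabilityMeasure μ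
  have : Nonempty α := ⟨f x₀⟩
  have hdense := Measure.MeasureDense.of_generateFrom_isSetAlgebra_finite (μ := μ)
    isSetAlgebra_measurableCylinders generateFrom_measurableCylinders.symm
  have hη' : 0 < η / Fintype.card α := div_pos hη (by simp [Fintype.card_pos])
  choose C hC hCμ using fun a : α => hdense.approx (f ⁻¹' {a})
    (hf (measurableSet_singleton a)) (measure_ne_top _ _) _ hη'
  let g (x : ι → K) : α := Classical.epsilon fun a => x ∈ C a
  have hsub : {x | f x ≠ g x} ⊆ ⋃ a, symmDiff (f ⁻¹' {a}) (C a) := by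
    intro x hx
    by_contra hmem
    have hiff (a : α) : x ∈ C a ↔ f x = a := by
      have := fun h => hmem (Set.mem_iUnion.2 ⟨a, h⟩)
      simp only [Set.mem_symmDiff, Set.mem_preimage, Set.mem_singleton_iff] at this
      tauto
    exact hx ((hiff _).1 (Classical.epsilon_spec (p := fun a => x ∈ C a) ⟨f x, (hiff _).2 rfl⟩))
  have hg : IsLocal g :=
    (isLocal_pi fun a => isLocal_mem_of_mem_measurableCylinders (hC a)).comp
      (measurable_of_finite Classical.epsilon)
  refine ⟨g, hg, ?_⟩
  calc μ.real {x | f x ≠ g x}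
      ≤ μ.real (⋃ a, symmDiff (f ⁻¹' {a}) (C a)) := measureReal_mono hsub
    _ ≤ ∑ a, μ.real (symmDiff (f ⁻¹' {a}) (C a)) := measureReal_iUnion_fintype_le _
    _ ≤ ∑ _a : α, η / Fintype.card α := Finset.sum_le_sum fun a _ =>
        ENNReal.toReal_le_of_le_ofReal hη'.le (hCμ a).le
    _ = η := by simp [mul_div_cancel₀]

end Local

instance isProbabilityMeasure_bernoulliMeasure (G : Type*) {K : Type*} [MeasurableSpace K]
    (κ : Measure K) [IsProbabilityMeasure κ] : IsProbabilityMeasure (bernoulliMeasure G κ) :=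
  inferInstanceAs (IsProbabilityMeasure (Measure.infinitePi fun _ : G => κ))

theorem measurePreserving_eval_bernoulliMeasure {G K : Type*} [MeasurableSpace K] (κ : Measure K)
    [IsProbabilityMeasure κ] (g : G) :
    MeasurePreserving (fun y : BernoulliSpace G K => y g) (bernoulliMeasure G κ) κ :=
  measurePreserving_eval_infinitePi (fun _ : G => κ) g

instance BernoulliSpace.instMeasurableConstSMul {G K : Type*} [Group G] [MeasurableSpace K] :
    MeasurableConstSMul G (BernoulliSpace G K) :=
  ⟨fun g => measurable_pi_lambda _ fun h => measurable_pi_apply (g⁻¹ * h)⟩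

instance smulInvariantMeasure_bernoulliMeasure {G K : Type*} [Group G] [MeasurableSpace K]
    (κ : Measure K) [IsProbabilityMeasure κ] :
    SMulInvariantMeasure G (BernoulliSpace G K) (bernoulliMeasure G κ) :=
  ⟨fun g _ hs => (measurePreserving_bernoulli_smul G κ g).measure_preimage hs.nullMeasurableSet⟩

section Itinerary

variable {G X α : Type*} [Group G] [MulAction G X]

/-- The sequence of letters that the orbit of `x` shows to the observable `a`. The inverse makes it
equivariant for the shift. -/
def itinerary (a : X → α) (x : X) : BernoulliSpace G α := fun g => a (g⁻¹ • x)

theorem measurable_itinerary [MeasurableSpace X] [MeasurableConstSMul G X] [MeasurableSpace α]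
    {a : X → α} (ha : Measurable a) : Measurable (itinerary (G := G) a) :=
  measurable_pi_lambda _ fun g => ha.comp (measurable_const_smul g⁻¹)

theorem smul_bernoulliSpace_apply {K : Type*} (g h : G) (y : BernoulliSpace G K) :
    (g • y) h = y (g⁻¹ * h) := rfl

theorem IsLocal.comp_itinerary {K β : Type*} [MeasurableSpace K] [MeasurableSpace α]
    [MeasurableSpace β] {a : BernoulliSpace G K → α} (ha : IsLocal a)
    {c : BernoulliSpace G α → β} (hc : IsLocal c) :
    IsLocal fun y : BernoulliSpace G K => c (itinerary a y) := by
  classical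
  obtain ⟨ham, E, hE⟩ := ha
  obtain ⟨hcm, D, hD⟩ := hc
  refine ⟨hcm.comp (measurable_itinerary (X := BernoulliSpace G K) ham),
    Finset.image₂ (· * ·) D E, fun (x y : BernoulliSpace G K) h => hD fun g hg => hE fun k hk => ?_⟩
  rw [smul_bernoulliSpace_apply, smul_bernoulliSpace_apply, inv_inv]
  exact h (g * k) (Finset.mem_image₂_of_mem hg hk)

theorem measureReal_itinerary_ne_le {B : Type*} [MeasurableSpace X] [MeasurableConstSMul G X]
    [MeasurableSpace α] [MeasurableSingletonClass α] [Finite α]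
    {μ : Measure X} [SMulInvariantMeasure G X μ] [IsFiniteMeasure μ]
    {a b : X → α} (ha : Measurable a) (hb : Measurable b) {c : BernoulliSpace G α → B}
    {D : Finset G} (hc : DependsOn c D) :
    μ.real {x | (a x, c (itinerary a x)) ≠ (b x, c (itinerary b x))} ≤
      (D.card + 1) * μ.real {x | a x ≠ b x} := by
  classical
  have hne : MeasurableSet {x | a x ≠ b x} := (measurableSet_eq_fun ha hb).compl
  have hsub : {x | (a x, c (itinerary a x)) ≠ (b x, c (itinerary b x))} ⊆
      {x | ∃ g ∈ insert 1 D, g⁻¹ • x ∈ {x | a x ≠ b x}} := by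
    intro x hx
    by_contra hmem
    have hagree (g : G) (hg : g ∈ insert 1 D) : a (g⁻¹ • x) = b (g⁻¹ • x) :=
      by_contra fun h => hmem ⟨g, hg, h⟩
    refine hx (Prod.ext ?_ (hc fun g hg => hagree g (Finset.mem_insert_of_mem hg)))
    simpa using hagree 1 (Finset.mem_insert_self 1 D)
  refine (measureReal_mono hsub).trans ((measureReal_exists_mem_preimage_le
    (fun g : G => measurePreserving_smul g⁻¹ μ) _ hne).trans ?_)
  gcongr
  exact_mod_cast Finset.card_insert_le 1 D

end Itinerary

section SoficModel

variable {G K α B : Type*} [Group G]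

theorem soficGoodSet_antitone {m : ℕ} (σ : G → Equiv.Perm (Fin m)) :
    Antitone (soficGoodSet σ) :=
  fun _ _ hF _ hv f₁ hf₁ f₂ hf₂ => hv f₁ (hF hf₁) f₂ (hF hf₂)

theorem IsSofic.exists_isSoficApproxMap (hG : IsSofic G) (T : Finset G) {ε : ℝ} (hε : 0 < ε) :
    ∃ (m : ℕ) (σ : G → Equiv.Perm (Fin m)), 0 < m ∧ IsSoficApproxMap σ (T : Set G) ε := by
  obtain ⟨m, σ, hm, F, ε', hmono, hcover, hε', happ⟩ := hG
  have hTF : ∀ᶠ i in atTop, ∀ t ∈ T, t ∈ F i := by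
    refine (Finset.eventually_all T).2 fun t _ => ?_
    obtain ⟨j, hj⟩ := Set.mem_iUnion.1 (hcover ▸ Set.mem_univ t)
    filter_upwards [eventually_ge_atTop j] with i hi using monotone_nat_of_le_succ hmono hi hj
  obtain ⟨i, hi, hεi⟩ := (hTF.and (hε'.eventually_lt_const hε)).exists
  refine ⟨m i, σ i, hm i, ?_⟩
  calc (1 - ε) * (m i : ℝ) ≤ (1 - ε' i) * m i := by gcongr
    _ ≤ (soficGoodSet (σ i) (F i)).ncard := happ i
    _ ≤ (soficGoodSet (σ i) T).ncard :=
        Nat.cast_le.2 (Set.ncard_le_ncard (soficGoodSet_antitone _ hi))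

/-- The configuration seen from the point `v` of the finite model `σ` whose points carry the
labels `ω`. -/
def pullbackName {m : ℕ} (σ : G → Equiv.Perm (Fin m)) (v : Fin m) (ω : Fin m → K) :
    BernoulliSpace G K :=
  fun g => ω (σ g⁻¹ v)

theorem measurable_pullbackName [MeasurableSpace K] {m : ℕ} (σ : G → Equiv.Perm (Fin m))
    (v : Fin m) : Measurable (pullbackName (K := K) σ v) :=
  measurable_pi_lambda _ fun _ => measurable_pi_apply _

theorem measurable_comp_pullbackName [MeasurableSpace K] [MeasurableSpace α]
    {a : BernoulliSpace G K → α} (ha : Measurable a) {m : ℕ} (σ : G → Equiv.Perm (Fin m)) :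
    Measurable fun (ω : Fin m → K) v => a (pullbackName σ v ω) :=
  measurable_pi_lambda _ fun v => ha.comp (measurable_pullbackName σ v)

variable {m : ℕ} {σ : G → Equiv.Perm (Fin m)} {F : Set G} {v : Fin m}

theorem pullbackName_one (h1 : 1 ∈ F) (hv : v ∈ soficGoodSet σ F) (ω : Fin m → K) :
    pullbackName σ v ω 1 = ω v := by
  have hσ : σ 1 v = v := (σ 1).injective (by simpa using (hv 1 h1 1 h1).1)
  simp [pullbackName, hσ]

theorem itinerary_pullbackName {a : BernoulliSpace G K → α} {E : Set G} (ha : DependsOn a E)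
    (hE : ∀ h ∈ E, h⁻¹ ∈ F) (hv : v ∈ soficGoodSet σ F) (ω : Fin m → K) {g : G} (hg : g⁻¹ ∈ F) :
    itinerary a (pullbackName σ v ω) g = pullbackName σ v (fun u => a (pullbackName σ u ω)) g := by
  refine ha fun h hh => ?_
  simp [smul_bernoulliSpace_apply, pullbackName, (hv _ (hE h hh) _ hg).1]

theorem integral_pullbackName [MeasurableSpace K] (κ : Measure K) [IsProbabilityMeasure κ]
    {f : BernoulliSpace G K → ℝ} (hf : Measurable f) {T : Finset G} (hT : DependsOn f T)
    (hTF : ∀ t ∈ T, t⁻¹ ∈ F) (hv : v ∈ soficGoodSet σ F) :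
    ∫ ω, f (pullbackName σ v ω) ∂Measure.infinitePi (fun _ : Fin m => κ) =
      ∫ y, f y ∂bernoulliMeasure G κ := by
  refine integral_infinitePi_comp_of_injOn κ hf hT fun s hs t ht hst => ?_
  by_contra hne
  exact (hv _ (hTF s hs) _ (hTF t ht)).2 (inv_injective.ne hne) hst

theorem exists_finset_integral_pullbackName_eq [MeasurableSpace K] [MeasurableSpace α]
    [MeasurableSpace B] (κ : Measure K) [IsProbabilityMeasure κ] {a : BernoulliSpace G K → α}
    (ha : IsLocal a) {c : BernoulliSpace G α → B} (hc : IsLocal c) {J : α × K × B → ℝ}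
    (hJ : Measurable J) :
    ∃ F : Finset G, ∀ {m : ℕ} {σ : G → Equiv.Perm (Fin m)} {v : Fin m},
      v ∈ soficGoodSet σ (F : Set G) →
      ∫ ω, J (a (pullbackName σ v ω), ω v, c (pullbackName σ v fun u => a (pullbackName σ u ω)))
          ∂Measure.infinitePi (fun _ : Fin m => κ) =
        ∫ y, J (a y, y 1, c (itinerary a y)) ∂bernoulliMeasure G κ := by
  classical
  obtain ⟨hf, T, hT⟩ := (ha.prodMk ((isLocal_eval 1).prodMk (ha.comp_itinerary hc))).comp hJ
  obtain ⟨-, E, hE⟩ := ha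
  obtain ⟨-, D, hD⟩ := hc
  let F : Finset G := insert 1 ((T ∪ E ∪ D).image (·⁻¹))
  have h1 : (1 : G) ∈ (F : Set G) := by simp [F]
  have hTF : ∀ t ∈ T, t⁻¹ ∈ (F : Set G) := fun t ht => by simp [F, ht]
  have hEF : ∀ t ∈ (E : Set G), t⁻¹ ∈ (F : Set G) := fun t ht => by simp_all [F]
  have hDF : ∀ t ∈ (D : Set G), t⁻¹ ∈ (F : Set G) := fun t ht => by simp_all [F]
  refine ⟨F, fun {m σ v} hv => ?_⟩
  rw [← integral_pullbackName κ hf hT hTF hv]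
  refine integral_congr_ae (ae_of_all _ fun ω => ?_)
  have hc := hD fun g hg => itinerary_pullbackName hE hEF hv ω (hDF g hg)
  simp only [hc, pullbackName_one h1 hv]

end SoficModel

section SoficBound

theorem sum_le_card_mul_add {V : Type*} [Fintype V] {t : V → ℝ} {I C ε : ℝ} {s : Set V}
    (hs : (1 - ε) * Fintype.card V ≤ s.ncard) (hgood : ∀ v ∈ s, t v ≤ I) (hC : 0 ≤ C)
    (hbad : ∀ v, t v ≤ I + C) : ∑ v, t v ≤ Fintype.card V * (I + ε * C) := by
  classical
  have hpointwise (v : V) : t v ≤ I + sᶜ.indicator (fun _ => C) v := by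
    by_cases hv : v ∈ s
    · simpa [hv] using hgood v hv
    · simpa [hv] using hbad v
  have hcard : (s.ncard : ℝ) + sᶜ.ncard = Fintype.card V := by
    exact_mod_cast (Set.ncard_add_ncard_compl s).trans Nat.card_eq_fintype_card
  have hsum : ∑ v, sᶜ.indicator (fun _ => C) v = sᶜ.ncard * C := by
    have h := Finset.sum_indicator_subset (fun _ => C) (Finset.subset_univ sᶜ.toFinset)
    simpa [Set.ncard_eq_toFinset_card'] using h
  have hncard : (sᶜ.ncard : ℝ) ≤ ε * Fintype.card V := by linarith
  calc ∑ v, t v ≤ ∑ v, (I + sᶜ.indicator (fun _ => C) v) :=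
        Finset.sum_le_sum fun v _ => hpointwise v
    _ = Fintype.card V * I + sᶜ.ncard * C := by simp [Finset.sum_add_distrib, hsum]
    _ ≤ Fintype.card V * I + ε * Fintype.card V * C := by gcongr
    _ = Fintype.card V * (I + ε * C) := by ring

variable {G K α B : Type*} [Group G] [MeasurableSpace K]
  [MeasurableSpace α] [MeasurableSingletonClass α]
  [Fintype B] [MeasurableSpace B] [MeasurableSingletonClass B]
  {κ : Measure K} [IsProbabilityMeasure κ] {β : K → B} {W : α → ℝ} {w : B → B → ℝ}

theorem mul_shannonEntropy_le_sum_integral_codeLength [Fintype α] (hβ : Measurable β)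
    (hW : ∀ a, 0 < W a) (hW1 : ∑ a, W a ≤ 1) (hw : ∀ b b', 0 < w b b')
    (hw1 : ∀ b, ∑ b', w b b' ≤ 1) {a : BernoulliSpace G K → α} (ha : Measurable a)
    (c : BernoulliSpace G α → B) {m : ℕ} (σ : G → Equiv.Perm (Fin m)) :
    m * shannonEntropy κ β ≤ ∑ v, ∫ ω, codeLength W w (a (pullbackName σ v ω), β (ω v),
      c (pullbackName σ v fun u => a (pullbackName σ u ω)))
        ∂Measure.infinitePi (fun _ : Fin m => κ) := by
  have hcoord (v : Fin m) : shannonEntropy (Measure.infinitePi fun _ : Fin m => κ)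
      (fun ω => β (ω v)) = shannonEntropy κ β :=
    shannonEntropy_comp_measurePreserving (measurePreserving_eval_infinitePi _ v) hβ
  have hindep : ProbabilityTheory.iIndepFun (fun v (ω : Fin m → K) => β (ω v))
      (Measure.infinitePi fun _ : Fin m => κ) :=
    ProbabilityTheory.iIndepFun_infinitePi fun _ => hβ
  have h := sum_shannonEntropy_le_sum_integral_codeLength hW hW1 hw hw1
    (fun v => hβ.comp (measurable_pi_apply v)) hindep (measurable_comp_pullbackName ha σ)
    fun v letters => c (pullbackName σ v letters)
  simpa only [Function.comp_def, hcoord, Finset.sum_const, Finset.card_univ, Fintype.card_fin,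
    nsmul_eq_mul] using h

theorem IsSofic.shannonEntropy_le_integral_codeLength_of_isLocal [Fintype α] (hG : IsSofic G)
    (hβ : Measurable β) (hW : ∀ a, 0 < W a) (hW1 : ∑ a, W a ≤ 1) (hw : ∀ b b', 0 < w b b')
    (hw1 : ∀ b, ∑ b', w b b' ≤ 1) {a : BernoulliSpace G K → α} (ha : IsLocal a)
    {c : BernoulliSpace G α → B} (hc : IsLocal c) :
    shannonEntropy κ β ≤
      ∫ y, codeLength W w (a y, β (y 1), c (itinerary a y)) ∂bernoulliMeasure G κ := by
  set I := ∫ y, codeLength W w (a y, β (y 1), c (itinerary a y)) ∂bernoulliMeasure G κ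
  obtain ⟨M, hM⟩ := Finite.exists_le (codeLength W w)
  have hJ : Measurable fun u : α × K × B => codeLength W w (u.1, β u.2.1, u.2.2) := by
    exact (measurable_of_finite (codeLength W w)).comp (by fun_prop)
  obtain ⟨F, hF⟩ := exists_finset_integral_pullbackName_eq κ ha hc hJ
  refine le_of_forall_pos_le_add_mul (C := |M - I|) fun ε hε => ?_
  obtain ⟨m, σ, hm, hσ⟩ := hG.exists_isSoficApproxMap F hε
  refine le_of_mul_le_mul_left ?_ (Nat.cast_pos.2 hm : (0 : ℝ) < m)
  refine (mul_shannonEntropy_le_sum_integral_codeLength hβ hW hW1 hw hw1 ha.1 c σ).trans ?_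
  have htriple (v : Fin m) : Measurable fun ω : Fin m → K => (a (pullbackName σ v ω), β (ω v),
      c (pullbackName σ v fun u => a (pullbackName σ u ω))) :=
    (ha.1.comp (measurable_pullbackName σ v)).prodMk ((hβ.comp (measurable_pi_apply v)).prodMk
      (hc.1.comp ((measurable_pullbackName σ v).comp (measurable_comp_pullbackName ha.1 σ))))
  have hbad (v : Fin m) : ∫ ω, codeLength W w (a (pullbackName σ v ω), β (ω v),
      c (pullbackName σ v fun u => a (pullbackName σ u ω)))
        ∂Measure.infinitePi (fun _ : Fin m => κ) ≤ I + |M - I| := by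
    refine (integral_mono (integrable_comp_of_finite (htriple v) _) (integrable_const M)
      fun ω => hM _).trans ?_
    simpa using sub_le_iff_le_add'.1 (le_abs_self (M - I))
  simpa using sum_le_card_mul_add (s := soficGoodSet σ (F : Set G))
    (by simpa [IsSoficApproxMap] using hσ)
    (fun v hv => (hF hv).le) (abs_nonneg _) hbad

theorem IsSofic.shannonEntropy_le_integral_codeLength [Fintype α] (hG : IsSofic G)
    (hβ : Measurable β) (hW : ∀ a, 0 < W a) (hW1 : ∑ a, W a ≤ 1) (hw : ∀ b b', 0 < w b b')
    (hw1 : ∀ b, ∑ b', w b b' ≤ 1) {a : BernoulliSpace G K → α} (ha : Measurable a)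
    {c : BernoulliSpace G α → B} (hc : IsLocal c) :
    shannonEntropy κ β ≤
      ∫ y, codeLength W w (a y, β (y 1), c (itinerary a y)) ∂bernoulliMeasure G κ := by
  obtain ⟨C, hC⟩ := Finite.exists_le
    fun u : (α × B × B) × (α × B × B) => codeLength W w u.1 - codeLength W w u.2
  have hJ (u u' : α × B × B) : codeLength W w u ≤ codeLength W w u' + |C| :=
    sub_le_iff_le_add'.1 ((hC (u, u')).trans (le_abs_self C))
  have htriple {b : BernoulliSpace G K → α} (hb : Measurable b) :
      Measurable fun y => (b y, β (y 1), c (itinerary b y)) :=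
    hb.prodMk ((hβ.comp (measurable_pi_apply 1)).prodMk (hc.1.comp (measurable_itinerary hb)))
  obtain ⟨D, hD⟩ := hc.2
  refine le_of_forall_pos_le_add_mul (C := (D.card + 1) * |C|) fun η hη => ?_
  obtain ⟨b, hb, hab⟩ : ∃ b : BernoulliSpace G K → α,
      IsLocal b ∧ (bernoulliMeasure G κ).real {y | a y ≠ b y} ≤ η :=
    exists_isLocal_approx (.infinitePi fun _ : G => κ) ha hη
  have hne : (bernoulliMeasure G κ).real
      {y | (b y, β (y 1), c (itinerary b y)) ≠ (a y, β (y 1), c (itinerary a y))} ≤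
        (D.card + 1) * η := by
    refine (measureReal_mono ?_).trans ((measureReal_itinerary_ne_le ha hb.1 hD).trans (by gcongr))
    rintro y hy h
    simp_all
  calc shannonEntropy κ β
      ≤ ∫ y, codeLength W w (b y, β (y 1), c (itinerary b y)) ∂bernoulliMeasure G κ :=
        hG.shannonEntropy_le_integral_codeLength_of_isLocal hβ hW hW1 hw hw1 hb hc
    _ ≤ ∫ y, codeLength W w (a y, β (y 1), c (itinerary a y)) ∂bernoulliMeasure G κ +
          (D.card + 1) * η * |C| :=
        (integral_comp_le_add_mul_measureReal_ne hJ (htriple hb.1) (htriple ha)).trans (by gcongr)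
    _ = _ := by ring

theorem IsSofic.shannonEntropy_le_shannonEntropy_sub_log [Finite α] (hG : IsSofic G)
    (hβ : Measurable β) {a : BernoulliSpace G K → α} (ha : Measurable a)
    {c : BernoulliSpace G α → B} (hc : IsLocal c) {δ : ℝ} (hδ₀ : 0 < δ) (hδ₁ : δ < 1) :
    shannonEntropy κ β ≤ shannonEntropy (bernoulliMeasure G κ) a - 2 * Real.log (1 - δ) -
      Real.log (δ / Fintype.card B) *
        (bernoulliMeasure G κ).real {y | β (y 1) ≠ c (itinerary a y)} := by
  cases nonempty_fintype α
  obtain ⟨y₀⟩ : Nonempty (BernoulliSpace G K) :=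
    nonempty_of_isProbabilityMeasure (bernoulliMeasure G κ)
  have : Nonempty α := ⟨a y₀⟩
  have hlaw : ∑ b, (bernoulliMeasure G κ).real (a ⁻¹' {b}) = 1 := by
    rw [sum_measureReal_preimage_singleton _ fun b _ => ha (measurableSet_singleton b)]
    simp
  have hW (b : α) : 0 < mixWithUniform δ (fun b => (bernoulliMeasure G κ).real (a ⁻¹' {b})) b :=
    mixWithUniform_pos hδ₀ hδ₁ measureReal_nonneg
  exact (hG.shannonEntropy_le_integral_codeLength hβ hW (sum_mixWithUniform hlaw).le
    (correctionWeight_pos hδ₀ hδ₁) (fun b => (sum_correctionWeight b).le) ha hc).trans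
    (integral_codeLength_correctionWeight_le hδ₀ hδ₁ ha (hβ.comp (measurable_pi_apply 1))
      (hc.1.comp (measurable_itinerary ha)))

end SoficBound

section BaseEntropy

/-- The information content `-log x` of an event of probability `x`; it is infinite for null
events. -/
noncomputable def informationContent (x : ℝ≥0∞) : ℝ≥0∞ := (-ENNReal.log x).toENNReal

theorem continuous_informationContent : Continuous informationContent :=
  EReal.continuous_toENNReal.comp (continuous_neg.comp ENNReal.continuous_log)

theorem antitone_informationContent : Antitone informationContent := fun _ _ h =>
  EReal.toENNReal_le_toENNReal (EReal.neg_le_neg_iff.2 (ENNReal.log_monotone h))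

theorem informationContent_zero : informationContent 0 = ⊤ := by
  simp [informationContent]

theorem informationContent_of_ne_zero {x : ℝ≥0∞} (h0 : x ≠ 0) (h1 : x ≠ ⊤) :
    informationContent x = ENNReal.ofReal (-Real.log x.toReal) := by
  rw [informationContent, ENNReal.log_pos_real h0 h1, ← EReal.coe_neg, EReal.real_coe_toENNReal]

theorem informationContent_mul_self {x : ℝ≥0∞} (h1 : x ≠ ⊤) :
    informationContent x * x = ENNReal.ofReal (Real.negMulLog x.toReal) := by
  rcases eq_or_ne x 0 with rfl | h0
  · simp
  · rw [informationContent_of_ne_zero h0 h1]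
    nth_rw 2 [← ENNReal.ofReal_toReal h1]
    rw [← ENNReal.ofReal_mul' ENNReal.toReal_nonneg, neg_mul, mul_comm, Real.negMulLog, neg_mul]

variable {K : Type*} [MeasurableSpace K]

theorem baseEntropy_eq_lintegral_informationContent [MeasurableSingletonClass K] (κ : Measure K)
    [IsProbabilityMeasure κ] : baseEntropy κ = ∫⁻ k, informationContent (κ {k}) ∂κ := by
  rw [baseEntropy]
  split_ifs with h
  · obtain ⟨K', hK', h1⟩ := h
    have hcompl : κ K'ᶜ = 0 := (prob_compl_eq_zero_iff hK'.measurableSet).2 h1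
    have hsupp : Function.support (fun k => ENNReal.ofReal (Real.negMulLog (κ.real {k}))) ⊆ K' := by
      refine Function.support_subset_iff'.2 fun k hk => ?_
      simp [measureReal_def, measure_mono_null (Set.singleton_subset_iff.2 hk) hcompl]
    have hrestrict : κ.restrict K' = κ := Measure.restrict_eq_self_of_ae_mem hcompl
    rw [← tsum_subtype_eq_of_support_subset hsupp]
    conv_rhs => rw [← hrestrict, lintegral_countable _ hK']
    rw [hrestrict]
    exact tsum_congr fun k => (informationContent_mul_self (measure_ne_top _ _)).symm
  · have hatoms : {k | 0 < κ {k}}.Countable :=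
      Measure.countable_meas_pos_of_disjoint_iUnion (As := fun k : K => {k})
        measurableSet_singleton fun i j hij => by simpa using hij
    have hpos : κ {k | 0 < κ {k}}ᶜ ≠ 0 := fun h0 =>
      h ⟨_, hatoms, (prob_compl_eq_zero_iff hatoms.measurableSet).1 h0⟩
    refine (top_le_iff.1 (le_trans (ENNReal.top_mul hpos).ge ?_)).symm
    rw [← setLIntegral_const]
    refine (setLIntegral_mono' hatoms.measurableSet.compl fun k hk => ?_).trans
      (setLIntegral_le_lintegral _ _)
    rw [show κ {k} = 0 by simpa using hk, informationContent_zero]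

theorem ofReal_shannonEntropy {B : Type*} [MeasurableSpace B] [MeasurableSingletonClass B]
    [Finite B] (κ : Measure K) [IsProbabilityMeasure κ] {β : K → B} (hβ : Measurable β) :
    ENNReal.ofReal (shannonEntropy κ β) = ∫⁻ k, informationContent (κ (β ⁻¹' {β k})) ∂κ := by
  rw [shannonEntropy, ofReal_integral_eq_lintegral_ofReal
    (integrable_comp_of_finite hβ fun b => -Real.log (κ.real (β ⁻¹' {b})))
    (ae_of_all _ fun k => neg_nonneg.2 (Real.log_nonpos measureReal_nonneg measureReal_le_one))]
  refine lintegral_congr_ae ?_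
  filter_upwards [ae_measureReal_preimage_singleton_pos β] with k hk
  have h0 : κ (β ⁻¹' {β k}) ≠ 0 := fun h => hk.ne' (by simp [measureReal_def, h])
  rw [informationContent_of_ne_zero h0 (measure_ne_top _ _), measureReal_def]

theorem ofReal_shannonEntropy_le_baseEntropy [MeasurableSingletonClass K] {B : Type*}
    [MeasurableSpace B] [MeasurableSingletonClass B] [Finite B] (κ : Measure K)
    [IsProbabilityMeasure κ] {β : K → B} (hβ : Measurable β) :
    ENNReal.ofReal (shannonEntropy κ β) ≤ baseEntropy κ := by
  rw [ofReal_shannonEntropy κ hβ, baseEntropy_eq_lintegral_informationContent]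
  exact lintegral_mono fun k => antitone_informationContent (measure_mono fun x hx => by simp_all)

theorem exists_seq_tendsto_measure_preimage_singleton [MeasurableSpace.CountablySeparated K]
    (κ : Measure K) [IsFiniteMeasure κ] :
    ∃ β : (n : ℕ) → K → Fin n → Bool, (∀ n, Measurable (β n)) ∧
      ∀ k, Tendsto (fun n => κ (β n ⁻¹' {β n k})) atTop (𝓝 (κ {k})) := by
  obtain ⟨f, hf, hinj⟩ := MeasurableSpace.measurable_injection_nat_bool_of_countablySeparated K
  let β (n : ℕ) (k : K) (i : Fin n) : Bool := f k i
  have hβ (n : ℕ) : Measurable (β n) :=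
    measurable_pi_lambda _ fun i => (measurable_pi_apply _).comp hf
  refine ⟨β, hβ, fun k => ?_⟩
  have hanti : Antitone fun n => β n ⁻¹' {β n k} := fun n m hnm x hx =>
    funext fun i => congrFun hx (Fin.castLE hnm i)
  have hinter : ⋂ n, β n ⁻¹' {β n k} = {k} := by
    refine Set.eq_singleton_iff_unique_mem.2 ⟨Set.mem_iInter.2 fun n => rfl, fun x hx => ?_⟩
    exact hinj (funext fun i => congrFun (Set.mem_iInter.1 hx (i + 1)) (Fin.last i))
  rw [← hinter]
  exact tendsto_measure_iInter_atTop
    (fun n => (hβ n (measurableSet_singleton _)).nullMeasurableSet) hanti ⟨0, measure_ne_top _ _⟩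

theorem exists_lt_shannonEntropy [MeasurableSpace.CountablySeparated K] (κ : Measure K)
    [IsProbabilityMeasure κ] {r : ℝ≥0∞} (hr : r < baseEntropy κ) :
    ∃ (n : ℕ) (β : K → Fin n → Bool), Measurable β ∧ r < ENNReal.ofReal (shannonEntropy κ β) := by
  have := MeasurableSpace.measurableSingletonClass_of_countablySeparated (α := K)
  obtain ⟨β, hβ, hlim⟩ := exists_seq_tendsto_measure_preimage_singleton κ
  have hliminf : baseEntropy κ ≤
      liminf (fun n => ENNReal.ofReal (shannonEntropy κ (β n))) atTop := by
    calc baseEntropy κ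
        = ∫⁻ k, liminf (fun n => informationContent (κ (β n ⁻¹' {β n k}))) atTop ∂κ := by
          rw [baseEntropy_eq_lintegral_informationContent]
          exact lintegral_congr fun k =>
            ((continuous_informationContent.tendsto _).comp (hlim k)).liminf_eq.symm
      _ ≤ liminf (fun n => ∫⁻ k, informationContent (κ (β n ⁻¹' {β n k})) ∂κ) atTop :=
          lintegral_liminf_le fun n =>
            (measurable_of_finite fun b => informationContent (κ (β n ⁻¹' {b}))).comp (hβ n)
      _ = liminf (fun n => ENNReal.ofReal (shannonEntropy κ (β n))) atTop := by
          simp only [ofReal_shannonEntropy κ (hβ _)]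
  obtain ⟨n, hn⟩ := (eventually_lt_of_lt_liminf (hr.trans_le hliminf)).exists
  exact ⟨n, β n, hβ n, hn⟩

theorem baseEntropy_map [MeasurableSingletonClass K] (κ : Measure K) [IsProbabilityMeasure κ]
    {K' : Type*} [MeasurableSpace K'] [MeasurableSingletonClass K'] (e : K ≃ᵐ K') :
    baseEntropy (κ.map e) = baseEntropy κ := by
  have := Measure.isProbabilityMeasure_map (μ := κ) e.measurable.aemeasurable
  rw [baseEntropy_eq_lintegral_informationContent, baseEntropy_eq_lintegral_informationContent,
    lintegral_map_equiv]
  refine lintegral_congr fun k => ?_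
  rw [e.map_apply, ← e.image_symm, Set.image_singleton, e.symm_apply_apply]

end BaseEntropy

section Conjugacy

variable {G X X₂ Y : Type*} [Group G] [MeasurableSpace X] [MulAction G X]
  [MeasurableSpace X₂] [MulAction G X₂] [MeasurableSpace Y] [MulAction G Y]
  {μ : Measure X} {μ₂ : Measure X₂} {ν : Measure Y}

theorem measurePreserving_subtype_val_of_compl_null {X' : Set X} (hX' : MeasurableSet X')
    (h : μ X'ᶜ = 0) : MeasurePreserving (Subtype.val : X' → X) (μ.comap Subtype.val) μ :=
  ⟨measurable_subtype_coe, by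
    rw [map_comap_subtype_coe hX', Measure.restrict_eq_self_of_ae_mem (mem_ae_iff.2 h)]⟩

theorem measurePreserving_comap_of_comp {Z : Type*} [MeasurableSpace Z] {f : X → Y}
    (hf : MeasurableEmbedding f) {r : Z → X} (hr : Measurable r) {ρ : Measure Z}
    (h : MeasurePreserving (f ∘ r) ρ ν) : MeasurePreserving r ρ (ν.comap f) :=
  ⟨hr, by rw [← h.map_eq, ← Measure.map_map hf.measurable hr, hf.comap_map]⟩

theorem IsMeasurablyConjugate.symm (h : IsMeasurablyConjugate G μ ν) :
    IsMeasurablyConjugate G ν μ := by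
  obtain ⟨X', Y', hX', hY', hμ, hν, φ, hφ, hequiv⟩ := h
  refine ⟨Y', X', hY', hX', hν, hμ, φ.symm, hφ.symm φ, fun g y => ?_⟩
  obtain ⟨hg, hgφ⟩ := hequiv g (φ.symm y)
  rw [φ.apply_symm_apply] at hgφ
  have hgy : g • (y : Y) ∈ Y' := hgφ ▸ (φ _).2
  have hφg : φ ⟨g • (φ.symm y : X), hg⟩ = ⟨g • (y : Y), hgy⟩ := Subtype.ext hgφ
  exact ⟨hgy, by rw [← hφg, φ.symm_apply_apply]⟩

theorem IsMeasurablyConjugate.comp_measurableEquiv (h : IsMeasurablyConjugate G μ₂ ν)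
    (e : X ≃ᵐ X₂) (he : MeasurePreserving e μ μ₂) (hequiv : ∀ (g : G) x, e (g • x) = g • e x) :
    IsMeasurablyConjugate G μ ν := by
  obtain ⟨X', Y', hX', hY', hμ, hν, φ, hφ, hφequiv⟩ := h
  let r : (e ⁻¹' X' : Set X) ≃ᵐ X' :=
    { e.toEquiv.subtypeEquiv fun _ => Iff.rfl with
      measurable_toFun := (e.measurable.comp measurable_subtype_coe).subtype_mk
      measurable_invFun := (e.symm.measurable.comp measurable_subtype_coe).subtype_mk }
  have hnull : μ (e ⁻¹' X')ᶜ = 0 := by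
    rw [← Set.preimage_compl, he.measure_preimage hX'.compl.nullMeasurableSet, hμ]
  have hr : MeasurePreserving r (μ.comap Subtype.val) (μ₂.comap Subtype.val) :=
    measurePreserving_comap_of_comp (.subtype_coe hX') r.measurable
      (he.comp (measurePreserving_subtype_val_of_compl_null (e.measurable hX') hnull))
  refine ⟨e ⁻¹' X', Y', e.measurable hX', hY', hnull, hν, r.trans φ, hφ.comp hr, fun g x => ?_⟩
  obtain ⟨hg, hgφ⟩ := hφequiv g (r x)
  have hgx : e (g • (x : X)) ∈ X' := hequiv g x ▸ hg
  have hrg : r ⟨g • (x : X), hgx⟩ = ⟨g • (r x : X₂), hg⟩ := Subtype.ext (hequiv g x)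
  exact ⟨hgx, by rw [r.trans_apply, r.trans_apply, hrg, hgφ]⟩

theorem IsMeasurablyConjugate.exists_maps [IsProbabilityMeasure μ] [IsProbabilityMeasure ν]
    (h : IsMeasurablyConjugate G μ ν) :
    ∃ (Ψ : X → Y) (Φ : Y → X), MeasurePreserving Ψ μ ν ∧ Measurable Φ ∧ (∀ᵐ x ∂μ, Φ (Ψ x) = x) ∧
      ∀ᵐ x ∂μ, ∀ g : G, Ψ (g • x) = g • Ψ x := by
  obtain ⟨X', Y', hX', hY', hμ, hν, φ, hφ, hequiv⟩ := h
  obtain ⟨Ψ, hΨ, hΨφ⟩ := (MeasurableEmbedding.subtype_coe hX').exists_measurable_extend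
    (measurable_subtype_coe.comp φ.measurable) fun _ => nonempty_of_isProbabilityMeasure ν
  obtain ⟨Φ, hΦ, hΦφ⟩ := (MeasurableEmbedding.subtype_coe hY').exists_measurable_extend
    (measurable_subtype_coe.comp φ.symm.measurable) fun _ => nonempty_of_isProbabilityMeasure μ
  have hΨ_apply (x : X') : Ψ x = φ x := congrFun hΨφ x
  have hΦ_apply (y : Y') : Φ y = φ.symm y := congrFun hΦφ y
  have hX'_ae : ∀ᵐ x ∂μ, x ∈ X' := mem_ae_iff.2 hμ
  refine ⟨Ψ, Φ, ⟨hΨ, ?_⟩, hΦ, ?_, ?_⟩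
  · rw [← (measurePreserving_subtype_val_of_compl_null hX' hμ).map_eq,
      Measure.map_map hΨ measurable_subtype_coe, hΨφ]
    exact ((measurePreserving_subtype_val_of_compl_null hY' hν).comp hφ).map_eq
  · filter_upwards [hX'_ae] with x hx
    rw [hΨ_apply ⟨x, hx⟩, hΦ_apply, φ.symm_apply_apply]
  · filter_upwards [hX'_ae] with x hx g
    obtain ⟨hg, hgφ⟩ := hequiv g ⟨x, hx⟩
    rw [hΨ_apply ⟨x, hx⟩, ← hgφ]
    exact hΨ_apply ⟨g • x, hg⟩

end Conjugacy

section Quantization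

variable {L : Type*} [MeasurableSpace L] [MeasurableSingletonClass L] {l : Measure L}
  [IsProbabilityMeasure l] {ε : ℝ}

theorem exists_finset_measureReal_compl_le (hl : baseEntropy l ≠ ⊤) (hε : 0 < ε) :
    ∃ S : Finset L, l.real (S : Set L)ᶜ ≤ ε := by
  classical
  obtain ⟨L', hL', h1⟩ : ∃ L' : Set L, L'.Countable ∧ l L' = 1 := by
    by_contra h
    exact hl (if_neg h)
  have := hL'.to_subtype
  let image (T : Finset L') : Finset L := T.image Subtype.val
  have hanti : Antitone fun T => (image T : Set L)ᶜ := fun _ _ hT =>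
    Set.compl_subset_compl.2 (Finset.coe_subset.2 (Finset.image_subset_image hT))
  have hinter : ⋂ T, (image T : Set L)ᶜ = L'ᶜ := by
    ext x
    simpa [image] using ⟨fun h hx => h {⟨x, hx⟩} hx (by simp), fun h _ hx => absurd hx h⟩
  have hlim := tendsto_measure_iInter_atTop (μ := l)
    (fun T => (image T).measurableSet.compl.nullMeasurableSet) hanti ⟨∅, measure_ne_top _ _⟩
  rw [hinter, (prob_compl_eq_zero_iff hL'.measurableSet).2 h1] at hlim
  obtain ⟨T, hT⟩ := (hlim.eventually_lt_const (ENNReal.ofReal_pos.2 hε)).exists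
  exact ⟨image T, ENNReal.toReal_le_of_le_ofReal hε.le hT.le⟩

theorem exists_measurable_retraction_finset (hl : baseEntropy l ≠ ⊤) (hε : 0 < ε) :
    ∃ (S : Finset L) (q : L → S), Measurable q ∧ l.real {x | (q x : L) ≠ x} ≤ ε := by
  classical
  obtain ⟨x₀⟩ : Nonempty L := nonempty_of_isProbabilityMeasure l
  obtain ⟨S, hS⟩ := exists_finset_measureReal_compl_le hl hε
  obtain ⟨q, hq, hqS⟩ := (MeasurableEmbedding.subtype_coe
    (insert x₀ S).measurableSet).exists_measurable_extend measurable_id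
      fun _ => ⟨⟨x₀, Finset.mem_insert_self x₀ S⟩⟩
  have hsub : {x | (q x : L) ≠ x} ⊆ (S : Set L)ᶜ := fun x hx hxS =>
    hx (congrArg Subtype.val (congrFun hqS ⟨x, Finset.mem_insert_of_mem hxS⟩))
  exact ⟨insert x₀ S, q, hq, (measureReal_mono hsub).trans hS⟩

theorem exists_isLocal_quantized_approx {G B : Type*} [MeasurableSpace B]
    [MeasurableSingletonClass B] [Finite B] (hl : baseEntropy l ≠ ⊤) {b : BernoulliSpace G L → B}
    (hb : Measurable b) (hε : 0 < ε) :
    ∃ (S : Finset L) (q : L → S) (c : BernoulliSpace G S → B), Measurable q ∧ IsLocal c ∧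
      (bernoulliMeasure G l).real {x | b x ≠ c fun g => q (x g)} ≤ ε := by
  obtain ⟨c, ⟨hc, D, hD⟩, hbc⟩ : ∃ c : BernoulliSpace G L → B,
      IsLocal c ∧ (bernoulliMeasure G l).real {x | b x ≠ c x} ≤ ε / 2 :=
    exists_isLocal_approx (.infinitePi fun _ : G => l) hb (half_pos hε)
  obtain ⟨S, q, hq, hqε⟩ := exists_measurable_retraction_finset hl
    (show 0 < ε / 2 / (D.card + 1) by positivity)
  have hne : MeasurableSet {x | (q x : L) ≠ x} :=
    (S.finite_toSet.subset fun x (hx : (q x : L) = x) => hx ▸ (q x).2).measurableSet.compl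
  refine ⟨S, q, fun z => c fun g => z g, hq, ⟨hc.comp (by fun_prop), D, fun x y h => hD fun g hg =>
    congrArg Subtype.val (h g hg)⟩, ?_⟩
  have hsub : {x : BernoulliSpace G L | b x ≠ c fun g => q (x g)} ⊆
      {x | b x ≠ c x} ∪ {x | ∃ g ∈ D, x g ∈ {x | (q x : L) ≠ x}} := by
    intro x hx
    by_contra hmem
    simp only [Set.mem_union, Set.mem_ofPred_eq, not_or, not_not, not_exists, not_and] at hmem
    exact hx (hmem.1.trans (hD fun g hg => (hmem.2 g hg).symm))
  calc (bernoulliMeasure G l).real {x | b x ≠ c fun g => q (x g)}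
      ≤ (bernoulliMeasure G l).real {x | b x ≠ c x} + (bernoulliMeasure G l).real
          {x | ∃ g ∈ D, x g ∈ {x | (q x : L) ≠ x}} :=
        (measureReal_mono hsub).trans (measureReal_union_le _ _)
    _ ≤ ε / 2 + D.card * (ε / 2 / (D.card + 1)) := by
        gcongr
        exact (measureReal_exists_mem_preimage_le
          (fun g => measurePreserving_eval_bernoulliMeasure l g) D hne).trans (by gcongr)
    _ ≤ ε := by
        have : D.card * (ε / 2 / (D.card + 1)) ≤ ε / 2 := by
          rw [mul_div_assoc', div_le_iff₀ (by positivity)]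
          nlinarith
        linarith

end Quantization

section EntropyInequality

variable {G K L B : Type*} [Group G] [MeasurableSpace K] [MeasurableSpace L]
  [MeasurableSingletonClass L] [MeasurableSpace B] [MeasurableSingletonClass B]
  {κ : Measure K} [IsProbabilityMeasure κ] {l : Measure L} [IsProbabilityMeasure l]
  {β : K → B} {Ψ : BernoulliSpace G K → BernoulliSpace G L}
  {Φ : BernoulliSpace G L → BernoulliSpace G K}

theorem exists_isLocal_itinerary_approx [Finite B] (hl : baseEntropy l ≠ ⊤) (hβ : Measurable β)
    (hΨ : MeasurePreserving Ψ (bernoulliMeasure G κ) (bernoulliMeasure G l)) (hΦ : Measurable Φ)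
    (hΦΨ : ∀ᵐ y ∂bernoulliMeasure G κ, Φ (Ψ y) = y)
    (hequiv : ∀ᵐ y ∂bernoulliMeasure G κ, ∀ g : G, Ψ (g • y) = g • Ψ y) {ε : ℝ} (hε : 0 < ε) :
    ∃ (S : Finset L) (q : L → S) (c : BernoulliSpace G S → B), Measurable q ∧ IsLocal c ∧
      (bernoulliMeasure G κ).real
        {y | β (y 1) ≠ c (itinerary (fun y => q (Ψ y 1)) y)} ≤ ε := by
  have hb : Measurable fun x : BernoulliSpace G L => β (Φ x 1) :=
    hβ.comp ((measurable_pi_apply 1).comp hΦ)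
  obtain ⟨S, q, c, hq, hc, hε'⟩ := exists_isLocal_quantized_approx hl hb hε
  refine ⟨S, q, c, hq, hc, le_of_eq_of_le ?_ hε'⟩
  have hcq : Measurable fun x : BernoulliSpace G L => c fun g => q (x g) :=
    hc.1.comp (measurable_pi_lambda _ fun g => hq.comp (measurable_pi_apply g))
  have hne : MeasurableSet {x : BernoulliSpace G L | β (Φ x 1) ≠ c fun g => q (x g)} :=
    (measurableSet_eq_fun hb hcq).compl
  rw [← hΨ.measureReal_preimage hne.nullMeasurableSet]
  refine measureReal_congr ?_
  filter_upwards [hΦΨ, hequiv] with y hy hyg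
  have hitinerary : itinerary (fun y => q (Ψ y 1)) y = fun g => q (Ψ y g) := by
    funext g
    simp [itinerary, hyg, smul_bernoulliSpace_apply]
  refine propext ?_
  change _ ≠ _ ↔ β (Φ (Ψ y) 1) ≠ _
  rw [hitinerary, hy]

theorem IsSofic.shannonEntropy_le_toReal_baseEntropy [Finite B] (hG : IsSofic G)
    (hl : baseEntropy l ≠ ⊤) (hβ : Measurable β)
    (hΨ : MeasurePreserving Ψ (bernoulliMeasure G κ) (bernoulliMeasure G l)) (hΦ : Measurable Φ)
    (hΦΨ : ∀ᵐ y ∂bernoulliMeasure G κ, Φ (Ψ y) = y)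
    (hequiv : ∀ᵐ y ∂bernoulliMeasure G κ, ∀ g : G, Ψ (g • y) = g • Ψ y) :
    shannonEntropy κ β ≤ (baseEntropy l).toReal := by
  cases nonempty_fintype B
  have hΨ₁ : MeasurePreserving (fun y => Ψ y 1) (bernoulliMeasure G κ) l :=
    (measurePreserving_eval_bernoulliMeasure l 1).comp hΨ
  have hδ {δ : ℝ} (hδ₀ : 0 < δ) (hδ₁ : δ < 1) :
      shannonEntropy κ β ≤ (baseEntropy l).toReal - 2 * Real.log (1 - δ) := by
    refine le_of_forall_pos_le_add_mul (C := |Real.log (δ / Fintype.card B)|) fun η hη => ?_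
    obtain ⟨S, q, c, hq, hc, hηc⟩ := exists_isLocal_itinerary_approx hl hβ hΨ hΦ hΦΨ hequiv hη
    have hletters : shannonEntropy (bernoulliMeasure G κ) (fun y => q (Ψ y 1)) ≤
        (baseEntropy l).toReal :=
      (shannonEntropy_comp_measurePreserving hΨ₁ hq).trans_le
        ((ENNReal.ofReal_le_iff_le_toReal hl).1 (ofReal_shannonEntropy_le_baseEntropy l hq))
    calc shannonEntropy κ β
        ≤ shannonEntropy (bernoulliMeasure G κ) (fun y => q (Ψ y 1)) - 2 * Real.log (1 - δ) -
            Real.log (δ / Fintype.card B) * (bernoulliMeasure G κ).real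
              {y | β (y 1) ≠ c (itinerary (fun y => q (Ψ y 1)) y)} :=
          hG.shannonEntropy_le_shannonEntropy_sub_log hβ (hq.comp hΨ₁.measurable) hc hδ₀ hδ₁
      _ ≤ (baseEntropy l).toReal - 2 * Real.log (1 - δ) +
            |Real.log (δ / Fintype.card B)| * η := by
          rw [sub_eq_add_neg (_ - _), ← neg_mul]
          gcongr
          exact neg_le_abs _
      _ = (baseEntropy l).toReal - 2 * Real.log (1 - δ) +
            η * |Real.log (δ / Fintype.card B)| := by ring
  refine le_of_forall_pos_le_add_mul (C := 2) fun ε hε => ?_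
  have h := hδ (δ := 1 - Real.exp (-ε)) (by simpa using hε) (by simp [Real.exp_pos])
  rw [sub_sub_cancel, Real.log_exp] at h
  linarith

theorem IsMeasurablyConjugate.baseEntropy_le [MeasurableSpace.CountablySeparated K]
    (hG : IsSofic G)
    (h : IsMeasurablyConjugate G (bernoulliMeasure G κ) (bernoulliMeasure G l)) :
    baseEntropy κ ≤ baseEntropy l := by
  by_contra! hlt
  obtain ⟨n, β, hβ, hβl⟩ := exists_lt_shannonEntropy κ hlt
  obtain ⟨Ψ, Φ, hΨ, hΦ, hΦΨ, hequiv⟩ := h.exists_maps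
  exact hβl.not_ge (ENNReal.ofReal_le_of_le_toReal
    (hG.shannonEntropy_le_toReal_baseEntropy hlt.ne_top hβ hΨ hΦ hΦΨ hequiv))

end EntropyInequality

section Ornstein

theorem IsMeasurablyConjugate.of_map_base {G K K' Y : Type*} [Group G] [MeasurableSpace K]
    [MeasurableSpace K'] [MeasurableSpace Y] [MulAction G Y] {κ : Measure K}
    [IsProbabilityMeasure κ] {e : K ≃ᵐ K'} [IsProbabilityMeasure (κ.map e)] {ν : Measure Y}
    (h : IsMeasurablyConjugate G (bernoulliMeasure G (κ.map e)) ν) :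
    IsMeasurablyConjugate G (bernoulliMeasure G κ) ν := by
  let E : BernoulliSpace G K ≃ᵐ BernoulliSpace G K' := MeasurableEquiv.piCongrRight fun _ => e
  have hE : MeasurePreserving E (bernoulliMeasure G κ) (bernoulliMeasure G (κ.map e)) :=
    ⟨E.measurable, Measure.infinitePi_map_pi (μ := fun _ : G => κ) fun _ => e.measurable⟩
  exact h.comp_measurableEquiv E hE fun _ _ => rfl

theorem exists_measurableEquiv_type (K : Type*) [MeasurableSpace K] [StandardBorelSpace K] :
    ∃ (K' : Type) (_ : MeasurableSpace K') (_ : StandardBorelSpace K'), Nonempty (K ≃ᵐ K') := by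
  have h := measurableEmbedding_embeddingReal K
  exact ⟨Set.range (embeddingReal K), inferInstance, h.measurableSet_range.standardBorel,
    ⟨h.equivRange⟩⟩

theorem IsOrnstein.isMeasurablyConjugate {G : Type*} [Group G] (hG : IsOrnstein G)
    {K₁ : Type*} [MeasurableSpace K₁] [StandardBorelSpace K₁]
    {K₂ : Type*} [MeasurableSpace K₂] [StandardBorelSpace K₂]
    {κ₁ : Measure K₁} [IsProbabilityMeasure κ₁] {κ₂ : Measure K₂} [IsProbabilityMeasure κ₂]
    (h : baseEntropy κ₁ = baseEntropy κ₂) :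
    IsMeasurablyConjugate G (bernoulliMeasure G κ₁) (bernoulliMeasure G κ₂) := by
  obtain ⟨L₁, _, _, ⟨e₁⟩⟩ := exists_measurableEquiv_type K₁
  obtain ⟨L₂, _, _, ⟨e₂⟩⟩ := exists_measurableEquiv_type K₂
  have := Measure.isProbabilityMeasure_map (μ := κ₁) e₁.measurable.aemeasurable
  have := Measure.isProbabilityMeasure_map (μ := κ₂) e₂.measurable.aemeasurable
  have hL : IsMeasurablyConjugate G (bernoulliMeasure G (κ₁.map e₁))
      (bernoulliMeasure G (κ₂.map e₂)) :=
    hG L₁ L₂ _ _ (by rw [baseEntropy_map, baseEntropy_map, h])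
  exact hL.of_map_base.symm.of_map_base.symm

end Ornstein

theorem mainTheorem4 {G : Type*} [Group G] [Countable G] (hsofic : IsSofic G)
    (hornstein : IsOrnstein G)
    {K₁ : Type*} [MeasurableSpace K₁] [StandardBorelSpace K₁]
    {K₂ : Type*} [MeasurableSpace K₂] [StandardBorelSpace K₂]
    (κ₁ : Measure K₁) [IsProbabilityMeasure κ₁] (κ₂ : Measure K₂) [IsProbabilityMeasure κ₂] :
    IsMeasurablyConjugate G (bernoulliMeasure G κ₁) (bernoulliMeasure G κ₂) ↔
      baseEntropy κ₁ = baseEntropy κ₂ := by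
  refine ⟨fun h => le_antisymm ?_ ?_, hornstein.isMeasurablyConjugate⟩
  · exact h.baseEntropy_le hsofic
  · exact h.symm.baseEntropy_le hsofic
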